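/- A process calculus consists of processes with free names, contexts (terms in which exactly one subterm is replaced by a hole; $C[P]$ denotes literal replacement of the hole by $P$, with possible capture of names of $P$ by binders of $C$), and a labelled transition system whose actions are either the invisible action $\tau$ or visible. Let $\Rightarrow$ be the reflexive and transitive closure of $\xrightarrow{\tau}$. A process $P$ is \emph{visible}, written $P\Downarrow$, if $P\Rightarrow\xrightarrow{\alpha}\Rightarrow P'$ for some visible action $\alpha$ and some $P'$; otherwise it is \emph{invisible}. It is \emph{closed} if it has no free name. A calculus is \emph{strongly replacement free} if $C[I]\Downarrow$ implies $C[P]\Downarrow$ for every context $C$, invisible process $I$ and process $P$; it is \emph{replacement free} if this holds for every context $C$, \emph{closed} invisible process $I$ and process $P$; it is \emph{weakly replacement free} if it is replacement free but not strongly replacement free. The $\pi_{MPM}$-calculus has the processes (up to renaming of bound names) $$P,Q ::= \mathbf 0 \mid \mu.P \mid P+Q \mid P\,|\,Q \mid (\nu n)P \mid\; !P \mid [n=m]P, \qquad \mu ::= \tau \mid \vec a(\vec x) \mid \vec a\langle \vec n\rangle,$$ over an infinite set of names, where channels $\vec a$ are nonempty tuples of names, output objects $\vec n$ are tuples of names,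 and input objects $\vec x$ are patterns: sequences of placeholders (possibly repeated, bound in the continuation) and of hooded names $\ulcorner n\urcorner$ (not binding, free in the process, standing for themselves). Its operational semantics is the standard early labelled transition semantics of the $\pi$-calculus (bound outputs, scope extrusion, and replication by the rule that $!P\xrightarrow{\mu}P'$ if $P\,|\,!P\xrightarrow{\mu}P'$), where $[n=m]P$ has the transitions of $P$ if $n=m$ and none otherwise, an input $\vec a(\vec x).P$ receives on $\vec a$ exactly the tuples $\vec b$ for which there is a substitution $\sigma$ of names for the placeholders of $\vec x$ with $\vec x\sigma=\vec b$ (hoods removed), and then becomes $P\sigma$, and an input and an output communicate only if their channel tuples are equal and the pattern matches the tuple sent. \textbf{Theorem.} The $\pi_{MPM}$-calculus is weakly replacement free. So is each of its three fragments 1. $\pi$-calculus with match: channels and output objects are single names, and input objects are single placeholders; 2. $\pi$-calculus with polyadic synchronization: there is no match operator, output objects are single names, and input objects are single placeholders; 3. $\pi$-calculus with pattern matching: there is no match operator, and channels are single names. -/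

import Mathlib

/-! ## Process calculi and replacement freeness -/

/-- A process calculus: processes, one-hole contexts with hole filling, free names, and a labelled
transition system with a distinguished invisible action `tau`; all other actions are visible. -/
structure Calculus where
  Name : Type
  Proc : Type
  Ctx : Type
  Act : Type
  tau : Act
  fill : Ctx → Proc → Proc
  fn : Proc → Set Name
  Tr : Proc → Act → Proc → Prop

namespace Calculus

variable (𝒞 : Calculus)

/-- The reflexive and transitive closure of the `tau`-transitions. -/
def TauStar : 𝒞.Proc → 𝒞.Proc → Prop :=
  Relation.ReflTransGen (fun P Q => 𝒞.Tr P 𝒞.tau Q)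

/-- Weak transition: some `tau`-steps, one step labelled `μ`, some `tau`-steps. -/
def WeakTr (P : 𝒞.Proc) (μ : 𝒞.Act) (P' : 𝒞.Proc) : Prop :=
  ∃ Q Q', 𝒞.TauStar P Q ∧ 𝒞.Tr Q μ Q' ∧ 𝒞.TauStar Q' P'

/-- `P` can perform the action `μ`. -/
def CanPerform (P : 𝒞.Proc) (μ : 𝒞.Act) : Prop := ∃ P', 𝒞.WeakTr P μ P'

/-- `P` can perform some visible action. -/
def Visible (P : 𝒞.Proc) : Prop := ∃ α, α ≠ 𝒞.tau ∧ 𝒞.CanPerform P α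

/-- `P` can perform no visible action. -/
def Invisible (P : 𝒞.Proc) : Prop := ¬ 𝒞.Visible P

/-- `P` has no free name. -/
def Closed (P : 𝒞.Proc) : Prop := 𝒞.fn P = ∅

def StronglyRepFree : Prop :=
  ∀ (C : 𝒞.Ctx) (I P : 𝒞.Proc), 𝒞.Invisible I →
    𝒞.Visible (𝒞.fill C I) → 𝒞.Visible (𝒞.fill C P)

def RepFree : Prop :=
  ∀ (C : 𝒞.Ctx) (I P : 𝒞.Proc), 𝒞.Closed I → 𝒞.Invisible I →
    𝒞.Visible (𝒞.fill C I) → 𝒞.Visible (𝒞.fill C P)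

def WeaklyRepFree : Prop := 𝒞.RepFree ∧ ¬ 𝒞.StronglyRepFree

/-- The subcalculus given by a set `p` of processes that is closed under transitions and a set `c`
of contexts whose filling preserves `p`. -/
def restrict (p : 𝒞.Proc → Prop) (c : 𝒞.Ctx → Prop)
    (hfill : ∀ C P, c C → p P → p (𝒞.fill C P))
    (_htr : ∀ P μ P', p P → 𝒞.Tr P μ P' → p P') : Calculus where
  Name := 𝒞.Name
  Proc := {P // p P}
  Ctx := {C // c C}
  Act := 𝒞.Act
  tau := 𝒞.tau
  fill C P := ⟨𝒞.fill C.1 P.1, hfill _ _ C.2 P.2⟩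
  fn P := 𝒞.fn P.1
  Tr P μ P' := 𝒞.Tr P.1 μ P'.1

end Calculus

/-! ## The pi-calculus with match, polyadic synchronization and pattern matching

Processes are considered up to renaming of bound names, through de Bruijn indices: a name is a
natural number, a binder for `m` names gives them the indices `0, …, m - 1` and increases the index
of every other name by `m`.  Filling the hole of a context is plain replacement, so the binders of
the context capture names of the process put into the hole, as they do with named binders. -/

namespace PiMPM

/-- Renaming `ρ`, carried below a binder for `m` names. -/
def up (m : ℕ) (ρ : ℕ → ℕ) (i : ℕ) : ℕ := if i < m then i else ρ (i - m) + m

/-- A channel: a nonempty tuple of names. -/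
structure Chan where
  head : ℕ
  tail : List ℕ

def Chan.names (a : Chan) : List ℕ := a.head :: a.tail

def Chan.rename (ρ : ℕ → ℕ) (a : Chan) : Chan := ⟨ρ a.head, a.tail.map ρ⟩

/-- An entry of a pattern with `m` placeholders: the `i`-th placeholder, or a hooded name, which
stands for itself. -/
inductive PatItem (m : ℕ) : Type
  | var (i : Fin m)
  | hood (n : ℕ)

/-- The name that an entry becomes when the placeholders are instantiated by `σ`. -/
def PatItem.inst {m : ℕ} (σ : Fin m → ℕ) : PatItem m → ℕ
  | var i => σ i
  | hood n => n

def PatItem.rename {m : ℕ} (ρ : ℕ → ℕ) : PatItem m → PatItem m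
  | var i => var i
  | hood n => hood (ρ n)

/-- A pattern: a sequence of placeholders (repetitions allowed) and hooded names; `arity` is the
number of distinct placeholders, and each of them occurs. -/
structure Pattern where
  arity : ℕ
  items : List (PatItem arity)
  occurs : ∀ i : Fin arity, PatItem.var i ∈ items

/-- Renaming of the names that occur free in a process through a pattern, i.e. the hooded ones. -/
def Pattern.rename (ρ : ℕ → ℕ) (x : Pattern) : Pattern where
  arity := x.arity
  items := x.items.map (PatItem.rename ρ)
  occurs i := List.mem_map.2 ⟨_, x.occurs i, rfl⟩

/-- The pattern `x` matches the tuple `b` and `σ` is the resulting substitution.  It is defined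
exactly on the placeholders of `x`, all of which occur in `x`, so it is unique. -/
def Pattern.Matches (x : Pattern) (b : List ℕ) (σ : Fin x.arity → ℕ) : Prop :=
  x.items.map (PatItem.inst σ) = b

/-- Processes: `0`, `τ.P`, `a(x).P`, `a⟨b⟩.P`, `P + Q`, `P | Q`, `(ν n)P`, `!P`, `[n = m]P`.
In `inp a x P` the placeholders of `x` are bound in `P`, in `res P` one name is bound in `P`. -/
inductive Proc : Type
  | nil
  | tau (P : Proc)
  | inp (a : Chan) (x : Pattern) (P : Proc)
  | out (a : Chan) (b : List ℕ) (P : Proc)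
  | sum (P Q : Proc)
  | par (P Q : Proc)
  | res (P : Proc)
  | rep (P : Proc)
  | mat (n m : ℕ) (P : Proc)

/-- One-hole contexts. -/
inductive Ctx : Type
  | hole
  | tau (C : Ctx)
  | inp (a : Chan) (x : Pattern) (C : Ctx)
  | out (a : Chan) (b : List ℕ) (C : Ctx)
  | sumL (C : Ctx) (Q : Proc)
  | sumR (P : Proc) (C : Ctx)
  | parL (C : Ctx) (Q : Proc)
  | parR (P : Proc) (C : Ctx)
  | res (C : Ctx)
  | rep (C : Ctx)
  | mat (n m : ℕ) (C : Ctx)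

def Ctx.fill : Ctx → Proc → Proc
  | hole, R => R
  | tau C, R => .tau (C.fill R)
  | inp a x C, R => .inp a x (C.fill R)
  | out a b C, R => .out a b (C.fill R)
  | sumL C Q, R => .sum (C.fill R) Q
  | sumR P C, R => .sum P (C.fill R)
  | parL C Q, R => .par (C.fill R) Q
  | parR P C, R => .par P (C.fill R)
  | res C, R => .res (C.fill R)
  | rep C, R => .rep (C.fill R)
  | mat n m C, R => .mat n m (C.fill R)

namespace Proc

/-- Capture-avoiding application of a substitution of names for names. -/
def rename : (ℕ → ℕ) → Proc → Proc
  | _, nil => nil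
  | ρ, tau P => tau (P.rename ρ)
  | ρ, inp a x P => inp (a.rename ρ) (x.rename ρ) (P.rename (up x.arity ρ))
  | ρ, out a b P => out (a.rename ρ) (b.map ρ) (P.rename ρ)
  | ρ, sum P Q => sum (P.rename ρ) (Q.rename ρ)
  | ρ, par P Q => par (P.rename ρ) (Q.rename ρ)
  | ρ, res P => res (P.rename (up 1 ρ))
  | ρ, rep P => rep (P.rename ρ)
  | ρ, mat n m P => mat (ρ n) (ρ m) (P.rename ρ)

/-- The free names of a process, given by their indices outside of the process. -/
def fn : Proc → Set ℕ
  | nil => ∅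
  | tau P => P.fn
  | inp a x P => {i | i ∈ a.names} ∪ {i | PatItem.hood i ∈ x.items} ∪ {i | i + x.arity ∈ P.fn}
  | out a b P => {i | i ∈ a.names} ∪ {i | i ∈ b} ∪ P.fn
  | sum P Q => P.fn ∪ Q.fn
  | par P Q => P.fn ∪ Q.fn
  | res P => {i | i + 1 ∈ P.fn}
  | rep P => P.fn
  | mat n m P => {n, m} ∪ P.fn

/-- The process below a binder for `k` names, none of which occurs in it. -/
def shift (k : ℕ) (P : Proc) : Proc := P.rename (fun i => i + k)

/-- `k` restrictions around `P`. -/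
def resN : ℕ → Proc → Proc
  | 0, P => P
  | k + 1, P => res (resN k P)

end Proc

/-- Actions: `τ`; the input `inp a b` of the tuple `b` on the channel `a`; the output `out k a b`
of the tuple `b` on the channel `a` with `k` extruded names.  In `out k a b` the extruded names are
`0, …, k - 1` in `b` and in the target of the transition, where all other names are increased by
`k`; they are not in the scope of `a`. -/
inductive Act : Type
  | tau
  | inp (a : Chan) (b : List ℕ)
  | out (k : ℕ) (a : Chan) (b : List ℕ)

/-- The number of names bound by an action. -/
def Act.bn : Act → ℕ
  | tau => 0
  | inp _ _ => 0
  | out k _ _ => k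

def Act.rename (ρ : ℕ → ℕ) : Act → Act
  | tau => tau
  | inp a b => inp (a.rename ρ) (b.map ρ)
  | out k a b => out k (a.rename ρ) (b.map (up k ρ))

/-- The substitution generated by an input prefix with `m` placeholders: the placeholders are
replaced according to `σ`, and the other names leave the scope of the prefix. -/
def instFun {m : ℕ} (σ : Fin m → ℕ) (i : ℕ) : ℕ := if h : i < m then σ ⟨i, h⟩ else i - m

/-- Exchange of a binder for one name with `k` extruded names: the bound name is `k` before and
`0` after the exchange, the extruded names are `0, …, k - 1` before and `1, …, k` after it. -/
def cyc (k i : ℕ) : ℕ := if i < k then i + 1 else if i = k then 0 else i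

/-- The (early) labelled transition system.  In `res`, the premise says that the restricted name,
which is `0` below the restriction, does not occur in the action.  In `opn`, the restricted name,
which is `k` below the names already extruded, does not occur in the channel, occurs in the tuple,
and becomes the last extruded name. -/
inductive Tr : Proc → Act → Proc → Prop
  | tau (P : Proc) : Tr (.tau P) .tau P
  | inp (a : Chan) (x : Pattern) (P : Proc) (b : List ℕ) (σ : Fin x.arity → ℕ)
      (h : x.Matches b σ) : Tr (.inp a x P) (.inp a b) (P.rename (instFun σ))
  | out (a : Chan) (b : List ℕ) (P : Proc) : Tr (.out a b P) (.out 0 a b) P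
  | sumL {P P' : Proc} {μ : Act} (Q : Proc) (h : Tr P μ P') : Tr (.sum P Q) μ P'
  | sumR {Q Q' : Proc} {μ : Act} (P : Proc) (h : Tr Q μ Q') : Tr (.sum P Q) μ Q'
  | parL {P P' : Proc} {μ : Act} (Q : Proc) (h : Tr P μ P') :
      Tr (.par P Q) μ (.par P' (Q.shift μ.bn))
  | parR {Q Q' : Proc} {μ : Act} (P : Proc) (h : Tr Q μ Q') :
      Tr (.par P Q) μ (.par (P.shift μ.bn) Q')
  | comL {P P' Q Q' : Proc} {k : ℕ} {a : Chan} {b : List ℕ} (hP : Tr P (.out k a b) P')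
      (hQ : Tr (Q.shift k) (.inp (a.rename (fun i => i + k)) b) Q') :
      Tr (.par P Q) .tau (Proc.resN k (.par P' Q'))
  | comR {P P' Q Q' : Proc} {k : ℕ} {a : Chan} {b : List ℕ}
      (hP : Tr (P.shift k) (.inp (a.rename (fun i => i + k)) b) P')
      (hQ : Tr Q (.out k a b) Q') :
      Tr (.par P Q) .tau (Proc.resN k (.par P' Q'))
  | res {P P' : Proc} {μ : Act} (h : Tr P (μ.rename Nat.succ) P') :
      Tr (.res P) μ (.res (P'.rename (cyc μ.bn)))
  | opn {P P' : Proc} {k : ℕ} {a : Chan} {b : List ℕ}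
      (h : Tr P (.out k (a.rename Nat.succ) b) P') (hk : k ∈ b) :
      Tr (.res P) (.out (k + 1) a b) P'
  | rep {P P' : Proc} {μ : Act} (h : Tr (.par P (.rep P)) μ P') : Tr (.rep P) μ P'
  | mat {P P' : Proc} {μ : Act} (n : ℕ) (h : Tr P μ P') : Tr (.mat n n P) μ P'

end PiMPM

/-- The pi-calculus with match, polyadic synchronization and pattern matching. -/
def piMPM : Calculus where
  Name := ℕ
  Proc := PiMPM.Proc
  Ctx := PiMPM.Ctx
  Act := PiMPM.Act
  tau := .tau
  fill := PiMPM.Ctx.fill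
  fn := PiMPM.Proc.fn
  Tr := PiMPM.Tr

/-! ## Fragments -/

namespace PiMPM

/-- Which of the three mechanisms are available. -/
structure Features where
  matching : Bool
  polySync : Bool
  patterns : Bool

namespace Features

variable (F : Features)

/-- Without polyadic synchronization, a channel is a single name. -/
def OkChan (a : Chan) : Prop := F.polySync = true ∨ a.tail = []

/-- Without pattern matching, the object of an input is a single placeholder. -/
def OkPat (x : Pattern) : Prop := F.patterns = true ∨ ∃ i, x.items = [.var i]

/-- Without pattern matching, the object of an output is a single name. -/
def OkTuple (b : List ℕ) : Prop := F.patterns = true ∨ ∃ n, b = [n]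

/-- The processes that use only the available mechanisms. -/
def OkProc : Proc → Prop
  | .nil => True
  | .tau P => OkProc P
  | .inp a x P => F.OkChan a ∧ F.OkPat x ∧ OkProc P
  | .out a b P => F.OkChan a ∧ F.OkTuple b ∧ OkProc P
  | .sum P Q => OkProc P ∧ OkProc Q
  | .par P Q => OkProc P ∧ OkProc Q
  | .res P => OkProc P
  | .rep P => OkProc P
  | .mat _ _ P => F.matching = true ∧ OkProc P

/-- The contexts that use only the available mechanisms. -/
def OkCtx : Ctx → Prop
  | .hole => True
  | .tau C => OkCtx C
  | .inp a x C => F.OkChan a ∧ F.OkPat x ∧ OkCtx C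
  | .out a b C => F.OkChan a ∧ F.OkTuple b ∧ OkCtx C
  | .sumL C Q => OkCtx C ∧ F.OkProc Q
  | .sumR P C => F.OkProc P ∧ OkCtx C
  | .parL C Q => OkCtx C ∧ F.OkProc Q
  | .parR P C => F.OkProc P ∧ OkCtx C
  | .res C => OkCtx C
  | .rep C => OkCtx C
  | .mat _ _ C => F.matching = true ∧ OkCtx C

theorem okProc_fill (C : Ctx) (P : Proc) (hC : F.OkCtx C) (hP : F.OkProc P) :
    F.OkProc (C.fill P) := by
  induction C <;> simp_all [OkCtx, OkProc, Ctx.fill]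

theorem okProc_rename (P : Proc) (ρ : ℕ → ℕ) (hP : F.OkProc P) : F.OkProc (P.rename ρ) := by
  induction P generalizing ρ with
  | inp a x P ih =>
    obtain ⟨h1, h2, h3⟩ := hP
    refine ⟨h1.imp id fun h => ?_, h2.imp id fun ⟨i, h⟩ => ⟨i, ?_⟩, ih _ h3⟩
    · simp [Chan.rename, h]
    · simp [Pattern.rename, h, PatItem.rename]
  | out a b P ih =>
    obtain ⟨h1, h2, h3⟩ := hP
    refine ⟨h1.imp id fun h => ?_, h2.imp id fun ⟨n, h⟩ => ⟨ρ n, ?_⟩, ih _ h3⟩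
    · simp [Chan.rename, h]
    · simp [h]
  | _ => simp_all [OkProc, Proc.rename]

theorem okProc_resN (k : ℕ) (P : Proc) (hP : F.OkProc P) : F.OkProc (P.resN k) := by
  induction k with
  | zero => exact hP
  | succ k ih => exact ih

theorem okProc_tr (P : Proc) (μ : Act) (P' : Proc) (hP : F.OkProc P) (h : Tr P μ P') :
    F.OkProc P' := by
  induction h with
  | tau P => exact hP
  | inp a x P b σ h => exact F.okProc_rename _ _ hP.2.2
  | out a b P => exact hP.2.2
  | sumL Q h ih => exact ih hP.1
  | sumR P h ih => exact ih hP.2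
  | parL Q h ih => exact ⟨ih hP.1, F.okProc_rename _ _ hP.2⟩
  | parR P h ih => exact ⟨F.okProc_rename _ _ hP.1, ih hP.2⟩
  | comL h1 h2 ih1 ih2 =>
    exact F.okProc_resN _ _ ⟨ih1 hP.1, ih2 (F.okProc_rename _ _ hP.2)⟩
  | comR h1 h2 ih1 ih2 =>
    exact F.okProc_resN _ _ ⟨ih1 (F.okProc_rename _ _ hP.1), ih2 hP.2⟩
  | res h ih => exact F.okProc_rename _ _ (ih hP)
  | opn h hk ih => exact ih hP
  | rep h ih => exact ih ⟨hP, hP⟩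
  | mat n h ih => exact ih hP.2

/-- The fragment of the calculus with the available mechanisms. -/
def calculus : Calculus :=
  piMPM.restrict F.OkProc F.OkCtx F.okProc_fill F.okProc_tr

end Features

end PiMPM

/-- The (monadic) pi-calculus with match. -/
def piMatch : Calculus := PiMPM.Features.calculus ⟨true, false, false⟩

/-- The (monadic) pi-calculus with polyadic synchronization. -/
def piPolySync : Calculus := PiMPM.Features.calculus ⟨false, true, false⟩

/-- The pi-calculus with pattern matching. -/
def piPattern : Calculus := PiMPM.Features.calculus ⟨false, false, true⟩

/-! ## Free names and transitions -/

namespace PiMPM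

/-! Replacement freeness is a simulation argument. Every visible action carries a nonempty channel
whose names are free in the acting process, so a closed process can only make τ-steps, and it stays
closed (`Tr.closed`). Relate `A` to `B` if `B` arises by putting arbitrary processes in place of
closed subterms of `A`. A move of a closed subterm is a τ-step, which `B` answers by standing still;
every other move, in particular each half of a communication, `B` copies (`Tr.answers`). Standing
still leaves `B` with a summand, a match or a replication that `A` has already resolved, and the
last four rules of `Repl` absorb exactly this. Visibility therefore passes from `A` to `B`
(`Repl.visible`).

Strong replacement freeness fails because a context can capture two free names of an open process
and identify them by a communication. Each of the three mechanisms can test two names for equality: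
the test is stuck while the names differ and signals once they coincide. With `nil` in the hole the
same context is closed, hence invisible. -/

theorem Chan.names_rename (ρ : ℕ → ℕ) (a : Chan) : (a.rename ρ).names = a.names.map ρ := rfl

theorem up_id (m : ℕ) : up m id = id := by
  funext i
  simp only [up, id]
  split <;> omega

theorem PatItem.rename_id {m : ℕ} : PatItem.rename (m := m) id = id := by
  funext x
  cases x <;> rfl

/-! ### Free names under renaming -/

namespace Proc

theorem rename_id (P : Proc) : P.rename id = P := by
  induction P with
  | inp a x P ih =>
    simp only [rename, up_id, ih]
    simp [Chan.rename, Pattern.rename, PatItem.rename_id]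
  | _ => simp_all [rename, up_id, Chan.rename]

theorem shift_zero (P : Proc) : P.shift 0 = P := P.rename_id

theorem rename_cyc_zero (P : Proc) : P.rename (cyc 0) = P := by
  have h : cyc 0 = id := by
    funext i
    simp only [cyc, id]
    split_ifs <;> omega
  rw [h, rename_id]

theorem exists_of_add_eq_up {m i j : ℕ} {ρ : ℕ → ℕ} (h : up m ρ j = i + m) :
    m ≤ j ∧ ρ (j - m) = i := by
  unfold up at h
  split at h <;> omega

theorem mem_fn_rename {P : Proc} {ρ : ℕ → ℕ} {i : ℕ} (h : i ∈ (P.rename ρ).fn) :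
    ∃ j ∈ P.fn, ρ j = i := by
  induction P generalizing ρ i with
  | nil => exact h.elim
  | tau P ih => exact ih h
  | inp a x P ih =>
    rcases h with (h | h) | h
    · obtain ⟨j, hj, rfl⟩ := List.mem_map.1 (Chan.names_rename ρ a ▸ h)
      exact ⟨j, .inl (.inl hj), rfl⟩
    · obtain ⟨y, hy, hi⟩ := List.mem_map.1 h
      cases y with
      | var => cases hi
      | hood j =>
        cases hi
        exact ⟨j, .inl (.inr hy), rfl⟩
    · obtain ⟨j, hj, hi⟩ := ih h
      obtain ⟨h1, h2⟩ := exists_of_add_eq_up hi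
      exact ⟨j - x.arity, .inr (by simpa [h1] using hj), h2⟩
  | out a b P ih =>
    rcases h with (h | h) | h
    · obtain ⟨j, hj, rfl⟩ := List.mem_map.1 (Chan.names_rename ρ a ▸ h)
      exact ⟨j, .inl (.inl hj), rfl⟩
    · obtain ⟨j, hj, rfl⟩ := List.mem_map.1 h
      exact ⟨j, .inl (.inr hj), rfl⟩
    · obtain ⟨j, hj, hi⟩ := ih h
      exact ⟨j, .inr hj, hi⟩
  | sum P Q ihP ihQ =>
    rcases h with h | h
    · obtain ⟨j, hj, hi⟩ := ihP h
      exact ⟨j, .inl hj, hi⟩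
    · obtain ⟨j, hj, hi⟩ := ihQ h
      exact ⟨j, .inr hj, hi⟩
  | par P Q ihP ihQ =>
    rcases h with h | h
    · obtain ⟨j, hj, hi⟩ := ihP h
      exact ⟨j, .inl hj, hi⟩
    · obtain ⟨j, hj, hi⟩ := ihQ h
      exact ⟨j, .inr hj, hi⟩
  | res P ih =>
    obtain ⟨j, hj, hi⟩ := ih h
    obtain ⟨h1, h2⟩ := exists_of_add_eq_up hi
    exact ⟨j - 1, by simpa [fn, h1] using hj, h2⟩
  | rep P ih => exact ih h
  | mat n m P ih =>
    rcases h with (h | h) | h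
    · exact ⟨n, .inl (.inl rfl), h.symm⟩
    · exact ⟨m, .inl (.inr rfl), h.symm⟩
    · obtain ⟨j, hj, hi⟩ := ih h
      exact ⟨j, .inr hj, hi⟩

theorem mem_fn_shift {P : Proc} {k i : ℕ} (h : i ∈ (P.shift k).fn) : k ≤ i ∧ i - k ∈ P.fn := by
  obtain ⟨j, hj, rfl⟩ := mem_fn_rename h
  simpa using hj

theorem mem_fn_resN {P : Proc} {k i : ℕ} : i ∈ (P.resN k).fn ↔ i + k ∈ P.fn := by
  induction k generalizing i with
  | zero => rfl
  | succ k ih => exact ih.trans (by rw [add_right_comm, add_assoc])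

theorem fn_rename_eq_empty {P : Proc} (h : P.fn = ∅) (ρ : ℕ → ℕ) : (P.rename ρ).fn = ∅ := by
  refine Set.eq_empty_of_forall_notMem fun i hi => ?_
  obtain ⟨j, hj, -⟩ := mem_fn_rename hi
  simp [h] at hj

end Proc

/-- The names of an action are free in a process with free names `s`, apart from those that it
extrudes or receives, and `t` may be the free names of the target. -/
def Act.Respects (s t : Set ℕ) : Act → Prop
  | tau => t ⊆ s
  | inp a b => (∀ i ∈ a.names, i ∈ s) ∧ ∀ i ∈ t, i ∈ s ∨ i ∈ b
  | out k a b => (∀ i ∈ a.names, i ∈ s) ∧ (∀ i ∈ b, k ≤ i → i - k ∈ s) ∧ ∀ i ∈ t, k ≤ i → i - k ∈ s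

theorem Act.Respects.mono {s s' t : Set ℕ} {μ : Act} (h : μ.Respects s t) (hs : s ⊆ s') :
    μ.Respects s' t := by
  cases μ with
  | tau => exact h.trans hs
  | inp a b => exact ⟨fun i hi => hs (h.1 i hi), fun i hi => (h.2 i hi).imp_left (@hs _)⟩
  | out k a b =>
    exact ⟨fun i hi => hs (h.1 i hi), fun i hi hk => hs (h.2.1 i hi hk),
      fun i hi hk => hs (h.2.2 i hi hk)⟩

theorem Act.Respects.union {s t u : Set ℕ} {μ : Act} (h : μ.Respects s t)
    (hu : ∀ i ∈ u, μ.bn ≤ i → i - μ.bn ∈ s) : μ.Respects s (t ∪ u) := by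
  cases μ with
  | tau => exact Set.union_subset h fun i hi => hu i hi (Nat.zero_le _)
  | inp a b =>
    exact ⟨h.1, fun i hi => hi.elim (h.2 i) fun hi => .inl (hu i hi (Nat.zero_le _))⟩
  | out k a b => exact ⟨h.1, h.2.1, fun i hi => hi.elim (h.2.2 i) (hu i)⟩

theorem Chan.mem_names_succ {a : Chan} {i : ℕ} (h : i ∈ a.names) :
    i + 1 ∈ (a.rename Nat.succ).names := by
  rw [Chan.names_rename]
  exact List.mem_map.2 ⟨i, h, rfl⟩

/-- A name of the receiver's target was either there before or received. A received name that is not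
extruded is already free in the sender, and the extruded ones are bound again by `resN`. -/
theorem subset_fn_res_com {P P' Q Q' : Proc} {k : ℕ} {a c : Chan} {b : List ℕ}
    (hP : (Act.out k a b).Respects P.fn P'.fn) (hQ : (Act.inp c b).Respects (Q.shift k).fn Q'.fn)
    {i : ℕ} (hi : i + k ∈ P'.fn ∨ i + k ∈ Q'.fn) : i ∈ P.fn ∨ i ∈ Q.fn := by
  rcases hi with hi | hi
  · exact .inl (by simpa using hP.2.2 _ hi (by omega))
  · rcases hQ.2 _ hi with hi | hi
    · exact .inr (by simpa using (Proc.mem_fn_shift hi).2)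
    · exact .inl (by simpa using hP.2.1 _ hi (by omega))

theorem Tr.respects {P P' : Proc} {μ : Act} (h : Tr P μ P') : μ.Respects P.fn P'.fn := by
  induction h with
  | tau P => exact subset_rfl
  | inp a x P b σ h =>
    refine ⟨fun i hi => .inl (.inl hi), fun i hi => ?_⟩
    obtain ⟨j, hj, rfl⟩ := Proc.mem_fn_rename hi
    unfold instFun
    split
    · right
      rw [← h]
      exact List.mem_map.2 ⟨_, x.occurs _, rfl⟩
    · exact .inl (.inr (by
        change _ + _ ∈ P.fn
        rwa [Nat.sub_add_cancel (by omega)]))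
  | out a b P =>
    exact ⟨fun i hi => .inl (.inl hi), fun i hi _ => .inl (.inr hi), fun i hi _ => .inr hi⟩
  | sumL Q h ih => exact ih.mono Set.subset_union_left
  | sumR P h ih => exact ih.mono Set.subset_union_right
  | parL Q h ih =>
    exact (ih.mono Set.subset_union_left).union fun i hi _ => .inr (Proc.mem_fn_shift hi).2
  | parR P h ih =>
    change Act.Respects _ (_ ∪ _) _
    rw [Set.union_comm (Proc.fn (Proc.shift _ _))]
    exact (ih.mono Set.subset_union_right).union fun i hi _ => .inl (Proc.mem_fn_shift hi).2
  | comL hP hQ ihP ihQ =>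
    exact fun i hi => subset_fn_res_com ihP ihQ (Proc.mem_fn_resN.1 hi)
  | comR hP hQ ihP ihQ =>
    exact fun i hi => (subset_fn_res_com ihQ ihP (Proc.mem_fn_resN.1 hi).symm).symm
  | @res P P' μ h ih =>
    -- `cyc` moves the restricted name to `0`, where `res` binds it again; a free name `i` of the
    -- target that is not extruded was `i + 1` in `P'`.
    have key : ∀ i, i ∈ (Proc.res (P'.rename (cyc μ.bn))).fn →
        i < μ.bn ∨ μ.bn ≤ i ∧ i + 1 ∈ P'.fn := by
      intro i hi
      obtain ⟨j, hj, hji⟩ := Proc.mem_fn_rename hi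
      unfold cyc at hji
      split_ifs at hji with h1 h2
      · omega
      · subst hji
        exact .inr ⟨by omega, hj⟩
    cases μ with
    | tau => exact fun i hi => ih ((key i hi).resolve_left (by simp [Act.bn])).2
    | inp a b =>
      refine ⟨fun i hi => ih.1 _ (Chan.mem_names_succ hi), fun i hi => ?_⟩
      refine (ih.2 _ ((key i hi).resolve_left (by simp [Act.bn])).2).imp id fun h => ?_
      obtain ⟨j, hj, hji⟩ := List.mem_map.1 h
      exact Nat.succ_injective hji ▸ hj
    | out k a b =>
      refine ⟨fun i hi => ih.1 _ (Chan.mem_names_succ hi), fun i hi hk => ?_, fun i hi hk => ?_⟩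
      · have := ih.2.1 (i + 1) (List.mem_map.2 ⟨i, hi, by unfold up; split <;> omega⟩) (by omega)
        rwa [Nat.sub_add_comm hk] at this
      · have := ih.2.2 (i + 1) ((key i hi).resolve_left (by simpa [Act.bn] using hk)).2 (by omega)
        rwa [Nat.sub_add_comm hk] at this
  | @opn P P' k a b h hk ih =>
    refine ⟨fun i hi => ih.1 _ (Chan.mem_names_succ hi), fun i hi hk => ?_, fun i hi hk => ?_⟩
    · have := ih.2.1 i hi (by omega)
      -- The opened name `k` now counts as extruded, so `i > k`, and `i - k` is a name of `P` other
      -- than the restricted `0`.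
      rwa [show i - k = i - (k + 1) + 1 by omega] at this
    · have := ih.2.2 i hi (by omega)
      rwa [show i - k = i - (k + 1) + 1 by omega] at this
  | rep h ih => exact ih.mono (Set.union_subset subset_rfl subset_rfl)
  | mat n h ih => exact ih.mono Set.subset_union_right

/-- A visible action would exhibit the head of its channel as a free name. -/
theorem Tr.closed {P P' : Proc} {μ : Act} (h : Tr P μ P') (hP : P.fn = ∅) :
    μ = .tau ∧ P'.fn = ∅ := by
  have := h.respects
  rw [hP] at this
  cases μ with
  | tau => exact ⟨rfl, Set.subset_empty_iff.1 this⟩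
  | inp a b => exact (this.1 a.head List.mem_cons_self).elim
  | out k a b => exact (this.1 a.head List.mem_cons_self).elim

/-! ## Replacing closed processes -/

/-- `Repl A B`: replacing closed subterms of `A` by arbitrary processes gives `B`, up to adding
summands, true matches, and folding replications in `B`. -/
inductive Repl : Proc → Proc → Prop
  | closed {A : Proc} (B : Proc) (h : A.fn = ∅) : Repl A B
  | nil : Repl .nil .nil
  | tau {A B : Proc} (h : Repl A B) : Repl (.tau A) (.tau B)
  | inp {A B : Proc} (a : Chan) (x : Pattern) (h : Repl A B) : Repl (.inp a x A) (.inp a x B)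
  | out {A B : Proc} (a : Chan) (b : List ℕ) (h : Repl A B) : Repl (.out a b A) (.out a b B)
  | sum {A A' B B' : Proc} (h : Repl A B) (h' : Repl A' B') : Repl (.sum A A') (.sum B B')
  | par {A A' B B' : Proc} (h : Repl A B) (h' : Repl A' B') : Repl (.par A A') (.par B B')
  | res {A B : Proc} (h : Repl A B) : Repl (.res A) (.res B)
  | rep {A B : Proc} (h : Repl A B) : Repl (.rep A) (.rep B)
  | mat {A B : Proc} (n m : ℕ) (h : Repl A B) : Repl (.mat n m A) (.mat n m B)
  | addR {A B : Proc} (Q : Proc) (h : Repl A B) : Repl A (.sum B Q)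
  | addL {A B : Proc} (Q : Proc) (h : Repl A B) : Repl A (.sum Q B)
  | fold {A B : Proc} (h : Repl A (.par B (.rep B))) : Repl A (.rep B)
  | guard {A B : Proc} (n : ℕ) (h : Repl A B) : Repl A (.mat n n B)

/-- The instances of `Repl` that relate two processes with the same outermost constructor. -/
inductive HeadRepl : Proc → Proc → Prop
  | nil : HeadRepl .nil .nil
  | tau {A B : Proc} (h : Repl A B) : HeadRepl (.tau A) (.tau B)
  | inp {A B : Proc} (a : Chan) (x : Pattern) (h : Repl A B) :
      HeadRepl (.inp a x A) (.inp a x B)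
  | out {A B : Proc} (a : Chan) (b : List ℕ) (h : Repl A B) :
      HeadRepl (.out a b A) (.out a b B)
  | sum {A A' B B' : Proc} (h : Repl A B) (h' : Repl A' B') : HeadRepl (.sum A A') (.sum B B')
  | par {A A' B B' : Proc} (h : Repl A B) (h' : Repl A' B') : HeadRepl (.par A A') (.par B B')
  | res {A B : Proc} (h : Repl A B) : HeadRepl (.res A) (.res B)
  | rep {A B : Proc} (h : Repl A B) : HeadRepl (.rep A) (.rep B)
  | mat {A B : Proc} (n m : ℕ) (h : Repl A B) : HeadRepl (.mat n m A) (.mat n m B)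

namespace Repl

theorem refl (A : Proc) : Repl A A := by
  induction A with
  | nil => exact .nil
  | tau P ih => exact .tau ih
  | inp a x P ih => exact .inp a x ih
  | out a b P ih => exact .out a b ih
  | sum P Q ihP ihQ => exact .sum ihP ihQ
  | par P Q ihP ihQ => exact .par ihP ihQ
  | res P ih => exact .res ih
  | rep P ih => exact .rep ih
  | mat n m P ih => exact .mat n m ih

theorem fill {A B : Proc} (h : Repl A B) (C : Ctx) : Repl (C.fill A) (C.fill B) := by
  induction C with
  | hole => exact h
  | tau C ih => exact .tau ih
  | inp a x C ih => exact .inp a x ih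
  | out a b C ih => exact .out a b ih
  | sumL C Q ih => exact .sum ih (.refl Q)
  | sumR P C ih => exact .sum (.refl P) ih
  | parL C Q ih => exact .par ih (.refl Q)
  | parR P C ih => exact .par (.refl P) ih
  | res C ih => exact .res ih
  | rep C ih => exact .rep ih
  | mat n m C ih => exact .mat n m ih

theorem rename {A B : Proc} (h : Repl A B) (ρ : ℕ → ℕ) : Repl (A.rename ρ) (B.rename ρ) := by
  induction h generalizing ρ with
  | closed B h => exact .closed _ (Proc.fn_rename_eq_empty h ρ)
  | nil => exact .nil
  | tau h ih => exact .tau (ih ρ)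
  | inp a x h ih => exact .inp _ _ (ih _)
  | out a b h ih => exact .out _ _ (ih _)
  | sum h h' ih ih' => exact .sum (ih ρ) (ih' ρ)
  | par h h' ih ih' => exact .par (ih ρ) (ih' ρ)
  | res h ih => exact .res (ih _)
  | rep h ih => exact .rep (ih ρ)
  | mat n m h ih => exact .mat _ _ (ih ρ)
  | addR Q h ih => exact .addR _ (ih ρ)
  | addL Q h ih => exact .addL _ (ih ρ)
  | fold h ih => exact .fold (ih ρ)
  | guard n h ih => exact .guard _ (ih ρ)

theorem shift {A B : Proc} (h : Repl A B) (k : ℕ) : Repl (A.shift k) (B.shift k) := h.rename _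

theorem resN {A B : Proc} (h : Repl A B) (k : ℕ) : Repl (A.resN k) (B.resN k) := by
  induction k with
  | zero => exact h
  | succ k ih => exact .res ih

end Repl

/-! ### The simulation -/

/-- `B` answers a transition of some process to `A'` labelled `μ`, by the same action or, if the
action is invisible, by doing nothing. -/
def Answers (μ : Act) (A' B : Proc) : Prop :=
  (∃ B', Tr B μ B' ∧ Repl A' B') ∨ μ = .tau ∧ Repl A' B

theorem Answers.of_tr {μ : Act} {A' B D : Proc} (h : Answers μ A' B)
    (htr : ∀ B', Tr B μ B' → Tr D μ B') (hrepl : Repl A' B → Repl A' D) : Answers μ A' D :=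
  h.imp (fun ⟨B', hB, hA⟩ => ⟨B', htr _ hB, hA⟩) (And.imp_right hrepl)

theorem Answers.exists_tr {μ : Act} {A' B : Proc} (h : Answers μ A' B) (hμ : μ ≠ .tau) :
    ∃ B', Tr B μ B' ∧ Repl A' B' :=
  h.resolve_right fun h => hμ h.1

/-- `B` may be wrapped in any number of extra summands, true matches and folded replications. Each
wrapper inherits the transitions of what it wraps and stays related to `A'`, so these layers can be
peeled off and only the case of equal outermost constructors remains. -/
theorem Repl.answers_of_head {A A' B : Proc} {μ : Act} (h : Repl A B) (htr : Tr A μ A')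
    (hcore : ∀ B, HeadRepl A B → Answers μ A' B) : Answers μ A' B := by
  induction h with
  | closed B h => exact .inr ⟨(htr.closed h).1, .closed B (htr.closed h).2⟩
  | nil => exact hcore _ .nil
  | tau h => exact hcore _ (.tau h)
  | inp a x h => exact hcore _ (.inp a x h)
  | out a b h => exact hcore _ (.out a b h)
  | sum h h' => exact hcore _ (.sum h h')
  | par h h' => exact hcore _ (.par h h')
  | res h => exact hcore _ (.res h)
  | rep h => exact hcore _ (.rep h)
  | mat n m h => exact hcore _ (.mat n m h)
  | addR Q h ih => exact (ih htr hcore).of_tr (fun _ => .sumL Q) (.addR Q)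
  | addL Q h ih => exact (ih htr hcore).of_tr (fun _ => .sumR Q) (.addL Q)
  | fold h ih => exact (ih htr hcore).of_tr (fun _ => .rep) .fold
  | guard n h ih => exact (ih htr hcore).of_tr (fun _ => .mat n) (.guard n)

theorem Tr.answers {A A' B : Proc} {μ : Act} (h : Tr A μ A') (hR : Repl A B) :
    Answers μ A' B := by
  induction h generalizing B with
  | tau P =>
    refine hR.answers_of_head (.tau P) fun B hB => ?_
    cases hB with
    | tau h => exact .inl ⟨_, .tau _, h⟩
  | inp a x P b σ h =>
    refine hR.answers_of_head (.inp a x P b σ h) fun B hB => ?_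
    cases hB with
    | inp _ _ hP => exact .inl ⟨_, .inp a x _ b σ h, hP.rename _⟩
  | out a b P =>
    refine hR.answers_of_head (.out a b P) fun B hB => ?_
    cases hB with
    | out _ _ hP => exact .inl ⟨_, .out a b _, hP⟩
  | sumL Q h ih =>
    refine hR.answers_of_head (.sumL Q h) fun B hB => ?_
    cases hB with
    -- If the moving summand is answered by inaction, the sum on the right stays unresolved; `addR`
    -- keeps it related.
    | sum h1 h2 => exact (ih h1).of_tr (fun _ => .sumL _) (.addR _)
  | sumR P h ih =>
    refine hR.answers_of_head (.sumR P h) fun B hB => ?_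
    cases hB with
    | sum h1 h2 => exact (ih h2).of_tr (fun _ => .sumR _) (.addL _)
  | parL Q h ih =>
    refine hR.answers_of_head (.parL Q h) fun B hB => ?_
    cases hB with
    | par h1 h2 =>
      rcases ih h1 with ⟨B', hB, hA⟩ | ⟨rfl, hA⟩
      · exact .inl ⟨_, .parL _ hB, .par hA (h2.shift _)⟩
      · exact .inr ⟨rfl, .par hA ((Proc.shift_zero Q).symm ▸ h2)⟩
  | parR P h ih =>
    refine hR.answers_of_head (.parR P h) fun B hB => ?_
    cases hB with
    | par h1 h2 =>
      rcases ih h2 with ⟨B', hB, hA⟩ | ⟨rfl, hA⟩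
      · exact .inl ⟨_, .parR _ hB, .par (h1.shift _) hA⟩
      · exact .inr ⟨rfl, .par ((Proc.shift_zero P).symm ▸ h1) hA⟩
  | comL hP hQ ihP ihQ =>
    refine hR.answers_of_head (.comL hP hQ) fun B hB => ?_
    cases hB with
    | par h1 h2 =>
      -- Both halves of a communication are visible, so neither can be answered by inaction.
      obtain ⟨B1, hB1, hA1⟩ := (ihP h1).exists_tr (by simp)
      obtain ⟨B2, hB2, hA2⟩ := (ihQ (h2.shift _)).exists_tr (by simp)
      exact .inl ⟨_, .comL hB1 hB2, (hA1.par hA2).resN _⟩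
  | comR hP hQ ihP ihQ =>
    refine hR.answers_of_head (.comR hP hQ) fun B hB => ?_
    cases hB with
    | par h1 h2 =>
      obtain ⟨B1, hB1, hA1⟩ := (ihP (h1.shift _)).exists_tr (by simp)
      obtain ⟨B2, hB2, hA2⟩ := (ihQ h2).exists_tr (by simp)
      exact .inl ⟨_, .comR hB1 hB2, (hA1.par hA2).resN _⟩
  | @res P P' μ h ih =>
    refine hR.answers_of_head (.res h) fun B hB => ?_
    cases hB with
    | res h1 =>
      rcases ih h1 with ⟨B', hB, hA⟩ | ⟨hμ, hA⟩
      · exact .inl ⟨_, .res hB, .res (hA.rename _)⟩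
      · cases μ with
        | tau => exact .inr ⟨rfl, .res ((Proc.rename_cyc_zero P').symm ▸ hA)⟩
        | inp a b => cases hμ
        | out k a b => cases hμ
  | opn h hk ih =>
    refine hR.answers_of_head (.opn h hk) fun B hB => ?_
    cases hB with
    | res h1 =>
      obtain ⟨B', hB, hA⟩ := (ih h1).exists_tr (by simp)
      exact .inl ⟨_, .opn hB hk, hA⟩
  | rep h ih =>
    refine hR.answers_of_head (.rep h) fun B hB => ?_
    cases hB with
    -- The premise is a move of the unfolding, answered by the unfolding of the right side; inaction
    -- there is folded back.
    | rep h1 => exact (ih (.par h1 (.rep h1))).of_tr (fun _ => .rep) .fold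
  | mat n h ih =>
    refine hR.answers_of_head (.mat n h) fun B hB => ?_
    cases hB with
    | mat _ _ h1 => exact (ih h1).of_tr (fun _ => .mat n) (.guard n)

theorem Repl.visible {A B : Proc} (h : Repl A B) (hA : piMPM.Visible A) : piMPM.Visible B := by
  obtain ⟨α, hα, -, Q, Q', hQ, hQ', -⟩ := hA
  have key : ∃ D, piMPM.TauStar B D ∧ Repl Q D := by
    clear hQ'
    induction hQ with
    | refl => exact ⟨B, .refl, h⟩
    | tail _ htr ih =>
      obtain ⟨D, hD, hR⟩ := ih
      rcases Tr.answers htr hR with ⟨D', hD', hR'⟩ | ⟨-, hR'⟩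
      · exact ⟨D', hD.tail hD', hR'⟩
      · exact ⟨D, hD, hR'⟩
  obtain ⟨D, hD, hR⟩ := key
  obtain ⟨D', hD', -⟩ := (Tr.answers hQ' hR).exists_tr hα
  exact ⟨α, hα, D', D, D', hD, hD', .refl⟩

theorem repFree : piMPM.RepFree := fun C _ P hI _ h => ((Repl.closed P hI).fill C).visible h

/-- A closed process is itself a replaceable closed subterm, so it is simulated by `nil`, which has
no transition. -/
theorem invisible_of_closed {P : Proc} (h : P.fn = ∅) : piMPM.Invisible P := by
  intro hv
  obtain ⟨α, hα, -, Q, Q', hQ, hQ', -⟩ := (Repl.closed .nil h).visible hv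
  rcases hQ.cases_head with rfl | ⟨R, hR, -⟩
  · cases hQ'
  · cases hR

theorem invisible_of_forall_not_tr {P : Proc} (h : ∀ μ P', ¬ Tr P μ P') : piMPM.Invisible P := by
  rintro ⟨α, hα, -, Q, Q', hQ, hQ', -⟩
  rcases hQ.cases_head with rfl | ⟨R, hR, -⟩
  · exact h _ _ hQ'
  · exact h _ _ hR

/-! ## Fragments -/

namespace Features

variable (F : Features)

theorem tauStar_calculus {P Q : F.calculus.Proc} (h : F.calculus.TauStar P Q) :
    piMPM.TauStar P.1 Q.1 := by
  induction h with
  | refl => exact .refl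
  | tail _ h ih => exact ih.tail h

theorem tauStar_calculus_of_tauStar {P Q : Proc} (hP : F.OkProc P) (h : piMPM.TauStar P Q) :
    ∃ hQ : F.OkProc Q, F.calculus.TauStar ⟨P, hP⟩ ⟨Q, hQ⟩ := by
  induction h with
  | refl => exact ⟨hP, .refl⟩
  | tail _ h ih =>
    obtain ⟨hQ, ih⟩ := ih
    exact ⟨F.okProc_tr _ _ _ hQ h, ih.tail h⟩

/-- A fragment is closed under transitions, so a run that starts in it never leaves it. -/
theorem visible_calculus_iff {P : F.calculus.Proc} :
    F.calculus.Visible P ↔ piMPM.Visible P.1 := by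
  constructor
  · rintro ⟨α, hα, -, Q, Q', hQ, hQ', -⟩
    exact ⟨α, hα, Q'.1, Q.1, Q'.1, F.tauStar_calculus hQ, hQ', .refl⟩
  · rintro ⟨α, hα, -, Q, Q', hQ, hQ', -⟩
    obtain ⟨h, hQ⟩ := F.tauStar_calculus_of_tauStar P.2 hQ
    exact ⟨α, hα, ⟨Q', F.okProc_tr _ _ _ h hQ'⟩, ⟨Q, h⟩, ⟨Q', F.okProc_tr _ _ _ h hQ'⟩, hQ, hQ',
      .refl⟩

theorem repFree_calculus : F.calculus.RepFree := by
  intro C I P hI hI' h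
  rw [visible_calculus_iff] at h ⊢
  exact repFree C.1 I.1 P.1 hI (fun hv => hI' (F.visible_calculus_iff.2 hv)) h

end Features

/-! ## Failure of strong replacement freeness -/

/-- The pattern that consists of a single placeholder. -/
def Pattern.single : Pattern where
  arity := 1
  items := [.var 0]
  occurs i := by simp [Subsingleton.elim i 0]

/-- The pattern that consists of a single hooded name. -/
def Pattern.hooded (n : ℕ) : Pattern where
  arity := 0
  items := [.hood n]
  occurs i := i.elim0

/-- The output of the name `n` on the channel `n`. -/
def signal (n : ℕ) : Proc := .out ⟨n, []⟩ [n] .nil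

/-- The context `(ν n)(ν c)(c⟨n⟩ | c(x).[ ])`, which identifies `x`, i.e. `0`, with `n`, i.e. `2`,
in its hole. -/
def unifier : Ctx := .res (.res (.parR (.out ⟨0, []⟩ [1] .nil) (.inp ⟨0, []⟩ .single .hole)))

theorem fn_fill_unifier_nil : (unifier.fill .nil).fn = ∅ := by
  ext i
  simp [unifier, Ctx.fill, Proc.fn, Chan.names, Pattern.single]

/-- In the hole, `x` is `0` and `n` is `2`. The substitution sends the placeholder `0` to `1` and
lowers `2` to `1`, which identifies them. -/
theorem tr_fill_unifier (I : Proc) :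
    Tr (unifier.fill I) .tau (.res (.res (.par .nil (I.rename (instFun fun _ : Fin 1 => 1))))) := by
  have h : Tr (.par (.out ⟨0, []⟩ [1] .nil) (.inp ⟨0, []⟩ .single I)) .tau
      (.par .nil (I.rename (instFun fun _ : Fin 1 => 1))) := by
    -- Both restrictions lie outside the parallel composition, so the output extrudes nothing.
    refine Tr.comL (k := 0) (.out _ _ _) ?_
    rw [Proc.shift_zero]
    exact .inp _ .single I [1] (fun _ => 1) rfl
  have h1 := Tr.res (μ := .tau) h
  have h2 := Tr.res (μ := .tau) h1
  simpa only [Act.bn, Proc.rename_cyc_zero, unifier, Ctx.fill] using h2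

theorem tauStar_res {P Q : Proc} (h : piMPM.TauStar P Q) :
    piMPM.TauStar (.res P) (.res Q) := by
  refine Relation.ReflTransGen.lift Proc.res (fun P Q h => ?_) _ _ h
  have := Tr.res (μ := .tau) h
  rwa [Act.bn, Proc.rename_cyc_zero] at this

theorem tauStar_par_right (R : Proc) {P Q : Proc} (h : piMPM.TauStar P Q) :
    piMPM.TauStar (.par R P) (.par R Q) := by
  refine Relation.ReflTransGen.lift (Proc.par R) (fun P Q h => ?_) _ _ h
  have := Tr.parR (μ := .tau) R h
  rwa [Act.bn, Proc.shift_zero] at this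

/-- The two restrictions remain after the communication, and the name `2` below them is the free
name `0` outside. -/
theorem visible_fill_unifier {I P P' : Proc}
    (h : piMPM.TauStar (I.rename (instFun fun _ : Fin 1 => 1)) P)
    (hP : Tr P (.out 0 ⟨2, []⟩ [2]) P') : piMPM.Visible (unifier.fill I) :=
  ⟨.out 0 ⟨0, []⟩ [0], fun h => (by cases h), _, _, _,
    .head (tr_fill_unifier I) (tauStar_res (tauStar_res (tauStar_par_right .nil h))),
    .res (.res (.parR .nil hP)), .refl⟩

/-- The process `[x = n]a⟨a⟩` in the hole of `unifier`. -/
def matchTest : Proc := .mat 0 2 (signal 3)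

/-- The process `(ν r)((n·r)⟨n⟩ | (x·r)(y).a⟨a⟩)` in the hole of `unifier`. -/
def polySyncTest : Proc :=
  .res (.par (.out ⟨3, [0]⟩ [3] .nil) (.inp ⟨1, [0]⟩ .single (signal 5)))

/-- The process `(ν r)(r⟨n⟩ | r(⌜x⌝).a⟨a⟩)` in the hole of `unifier`. -/
def patternTest : Proc :=
  .res (.par (.out ⟨0, []⟩ [3] .nil) (.inp ⟨0, []⟩ (.hooded 1) (signal 4)))

theorem visible_fill_matchTest : piMPM.Visible (unifier.fill matchTest) :=
  visible_fill_unifier .refl (.mat 1 (.out _ _ _))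

theorem visible_fill_polySyncTest : piMPM.Visible (unifier.fill polySyncTest) := by
  -- The substitution has turned both `n` and `x`, below the restriction of `r`, into `2`, so the
  -- two channels agree.
  have h : Tr (.par (.out ⟨2, [0]⟩ [2] .nil) (.inp ⟨2, [0]⟩ .single (signal 4))) .tau
      (.par .nil (signal 3)) := by
    refine Tr.comL (k := 0) (.out _ _ _) ?_
    rw [Proc.shift_zero]
    exact .inp _ .single _ [2] (fun _ => 2) rfl
  exact visible_fill_unifier (tauStar_res (.single h)) (.res (.parR .nil (.out _ _ _)))

theorem visible_fill_patternTest : piMPM.Visible (unifier.fill patternTest) := by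
  -- The hooded `x` has become `2`, the name that is sent.
  have h : Tr (.par (.out ⟨0, []⟩ [2] .nil) (.inp ⟨0, []⟩ (.hooded 2) (signal 3))) .tau
      (.par .nil (signal 3)) := by
    refine Tr.comL (k := 0) (.out _ _ _) ?_
    rw [Proc.shift_zero]
    exact .inp _ (.hooded 2) _ [2] Fin.elim0 rfl
  exact visible_fill_unifier (tauStar_res (.single h)) (.res (.parR .nil (.out _ _ _)))

/-! ### The tests are stuck before the names are identified -/

theorem not_tr_matchTest (μ : Act) (P' : Proc) : ¬ Tr matchTest μ P' := by
  intro h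
  cases h

theorem Tr.of_inp {a : Chan} {x : Pattern} {P P' : Proc} {μ : Act} (h : Tr (.inp a x P) μ P') :
    ∃ b σ, μ = .inp a b ∧ x.Matches b σ := by
  cases h with
  | inp _ _ _ b σ h => exact ⟨b, σ, rfl, h⟩

theorem Tr.of_out {a : Chan} {b : List ℕ} {P P' : Proc} {μ : Act} (h : Tr (.out a b P) μ P') :
    μ = .out 0 a b := by
  cases h
  rfl

/-- An output and an input in parallel act independently if they cannot communicate. -/
theorem Tr.of_out_par_inp {a c : Chan} {b : List ℕ} {x : Pattern} {P Q R : Proc} {μ : Act}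
    (h : Tr (.par (.out a b P) (.inp c x Q)) μ R) (hac : a = c → ∀ σ, ¬ x.Matches b σ) :
    μ = .out 0 a b ∨ ∃ b', μ = .inp c b' := by
  cases h with
  | parL _ h => exact .inl h.of_out
  | parR _ h =>
    obtain ⟨b', -, rfl, -⟩ := h.of_inp
    exact .inr ⟨b', rfl⟩
  | comL hP hQ =>
    have hout := hP.of_out
    simp only [Act.out.injEq] at hout
    obtain ⟨rfl, rfl, rfl⟩ := hout
    rw [Proc.shift_zero] at hQ
    obtain ⟨b', σ, h, hx⟩ := hQ.of_inp
    simp only [Act.inp.injEq] at h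
    obtain ⟨h, rfl⟩ := h
    exact (hac (by simpa [Chan.rename] using h) σ hx).elim
  | comR hP hQ =>
    obtain ⟨b', σ, h, hx⟩ := hQ.of_inp
    cases h

/-- Both rules for a restriction demand that the restricted name `0` not occur in the channel; `opn`
only extrudes names in the object. -/
theorem not_tr_res {P : Proc} {a c : Chan} {b : List ℕ} (ha : 0 ∈ a.names) (hc : 0 ∈ c.names)
    (h : ∀ μ P', Tr P μ P' → μ = .out 0 a b ∨ ∃ b', μ = .inp c b') (μ : Act) (P' : Proc) :
    ¬ Tr (.res P) μ P' := by
  have hsucc : ∀ d : Chan, 0 ∉ (d.rename Nat.succ).names := by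
    intro d hd
    rw [Chan.names_rename] at hd
    obtain ⟨j, -, hj⟩ := List.mem_map.1 hd
    exact Nat.succ_ne_zero j hj
  intro htr
  cases htr with
  | res htr =>
    rcases h _ _ htr with hμ | ⟨b', hμ⟩ <;> cases μ <;> simp only [Act.rename, Act.out.injEq,
      Act.inp.injEq, reduceCtorEq] at hμ
    · exact hsucc _ (hμ.2.1 ▸ ha)
    · exact hsucc _ (hμ.1 ▸ hc)
  | opn htr hk =>
    rcases h _ _ htr with hμ | ⟨b', hμ⟩ <;> simp only [Act.out.injEq, reduceCtorEq] at hμ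
    exact hsucc _ (hμ.2.1 ▸ ha)

theorem not_tr_polySyncTest (μ : Act) (P' : Proc) : ¬ Tr polySyncTest μ P' :=
  not_tr_res (by simp [Chan.names]) (by simp [Chan.names])
    -- The two channels differ in their first component, `3` against `1`.
    (fun _ _ h => h.of_out_par_inp fun h => by simp at h) μ P'

theorem not_tr_patternTest (μ : Act) (P' : Proc) : ¬ Tr patternTest μ P' :=
  not_tr_res (by simp [Chan.names]) (by simp [Chan.names])
    -- The channels agree here, but the hooded name `1` does not match the object `3`.
    (fun _ _ h => h.of_out_par_inp fun _ σ h => by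
      simp [Pattern.Matches, Pattern.hooded, PatItem.inst] at h) μ P'

theorem not_stronglyRepFree_of_visible_fill_unifier {I : Proc} (hI : ∀ μ P', ¬ Tr I μ P')
    (hv : piMPM.Visible (unifier.fill I)) : ¬ piMPM.StronglyRepFree := fun h =>
  invisible_of_closed fn_fill_unifier_nil
    (h unifier I .nil (invisible_of_forall_not_tr hI) hv)

/-- The context uses only monadic prefixes, so one context refutes strong replacement freeness in
all fragments. -/
theorem Features.okCtx_unifier (F : Features) : F.OkCtx unifier :=
  ⟨⟨.inr rfl, .inr ⟨1, rfl⟩, trivial⟩, .inr rfl, .inr ⟨(0 : Fin 1), rfl⟩, trivial⟩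

theorem Features.weaklyRepFree_calculus (F : Features) {I : Proc} (hF : F.OkProc I)
    (hI : ∀ μ P', ¬ Tr I μ P') (hv : piMPM.Visible (unifier.fill I)) :
    F.calculus.WeaklyRepFree := by
  refine ⟨F.repFree_calculus, fun h => ?_⟩
  have hnil := h ⟨unifier, F.okCtx_unifier⟩ ⟨I, hF⟩ ⟨.nil, trivial⟩
    (fun h => invisible_of_forall_not_tr hI (F.visible_calculus_iff.1 h))
    (F.visible_calculus_iff.2 hv)
  exact invisible_of_closed fn_fill_unifier_nil (F.visible_calculus_iff.1 hnil)

end PiMPM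

open PiMPM in
theorem mainTheorem5 :
    piMPM.WeaklyRepFree ∧
      piMatch.WeaklyRepFree ∧ piPolySync.WeaklyRepFree ∧ piPattern.WeaklyRepFree := by
  refine ⟨⟨repFree, not_stronglyRepFree_of_visible_fill_unifier not_tr_matchTest
      visible_fill_matchTest⟩,
    Features.weaklyRepFree_calculus _ ?_ not_tr_matchTest visible_fill_matchTest,
    Features.weaklyRepFree_calculus _ ?_ not_tr_polySyncTest visible_fill_polySyncTest,
    Features.weaklyRepFree_calculus _ ?_ not_tr_patternTest visible_fill_patternTest⟩
  · exact ⟨rfl, .inr rfl, .inr ⟨3, rfl⟩, trivial⟩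
  · exact ⟨⟨.inl rfl, .inr ⟨3, rfl⟩, trivial⟩, .inl rfl, .inr ⟨(0 : Fin 1), rfl⟩, .inr rfl, .inr ⟨5, rfl⟩,
      trivial⟩
  · exact ⟨⟨.inr rfl, .inl rfl, trivial⟩, .inr rfl, .inl rfl, .inr rfl, .inl rfl, trivial⟩
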